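/- Let $t\ge 3$ and let $G$ be a finite simple graph with $m$ edges. Write $P_j$ for the path with $j$ vertices (and $j-1$ edges) and $K_j$ for the complete graph on $j$ vertices, and let $\mathcal{K}_t(G)$ be the set of $t$-cliques of $G$, that is, of $t$-element sets of vertices that are pairwise adjacent in $G$. For $T\in\mathcal{K}_t(G)$ define \[ \beta_G(T)=\max\{k : T\subseteq V(S)\text{ for some (not necessarily induced) subgraph } S\subseteq G \text{ with } S\cong P_{k+1}\}, \qquad p'_G(T)=\frac{1}{\binom{\beta_G(T)-1}{t-2}} . \] Then the following hold. 1. For every $T\in\mathcal{K}_t(G)$ the weight $p'_G(T)$ is well-defined: the maximum $\beta_G(T)$ exists, $\beta_G(T)\ge t-1$, and $\binom{\beta_G(T)-1}{t-2}>0$. Moreover $p'_G(T)$ is strictly decreasing in $\beta_G(T)$: the function $k\mapsto 1/\binom{k-1}{t-2}$ is strictly decreasing on the integers $k\ge t-1$. 2. We have \[ \sum_{T\in\mathcal{K}_t(G)}p'_G(T)\le\frac{m}{\binom{t}{2}}, \] with equality if and only if $G$ is a disjoint union of complete graphs of order at least $t$ and any number of isolated vertices (either kind of component may be absent). 3. (Chakraborti--Chen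 bound.) If $r\ge t$ and $G$ has no subgraph isomorphic to $P_{r+1}$, then \[ |\mathcal{K}_t(G)|\le\frac{m}{\binom{r}{2}}\binom{r}{t}, \] with equality if and only if $\binom{r}{2}$ divides $m$ and $G$ is a disjoint union of copies of $K_r$ and any number of isolated vertices (either kind of component may be absent). -/

import Mathlib

namespace LocalPath

open SimpleGraph

/-- The lengths `k` of the paths in `G` that pass through every vertex of `T`: there is a subgraph
`S` of `G`, isomorphic to the path with `k + 1` vertices (and `k` edges), with `T ⊆ V(S)`. -/
def pathLengths {V : Type*} (G : SimpleGraph V) (T : Finset V) : Set ℕ :=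
  {k : ℕ | ∃ S : G.Subgraph, (T : Set V) ⊆ S.verts ∧ Nonempty (S.coe ≃g pathGraph (k + 1))}

/-- The path-length size function `β_G(T)`: the largest length of a path in `G` through every
vertex of `T`. -/
noncomputable def beta {V : Type*} (G : SimpleGraph V) (T : Finset V) : ℕ :=
  sSup (pathLengths G T)

/-- The function `k ↦ 1 / binom(k - 1, t - 2)` through which the weight depends on `β_G(T)`. -/
noncomputable def weightFun (t k : ℕ) : ℝ :=
  1 / ((k - 1).choose (t - 2) : ℝ)

/-- The weight `p'_G(T) = 1 / binom(β_G(T) - 1, t - 2)` of a `t`-clique `T`. -/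
noncomputable def weight {V : Type*} (G : SimpleGraph V) (t : ℕ) (T : Finset V) : ℝ :=
  weightFun t (beta G T)

/-- `G` is a disjoint union of complete graphs whose orders all lie in `N`: every connected
component of `G` is isomorphic to `K_k` for some `k ∈ N`. Isolated vertices are components `K_1`. -/
def IsDisjointUnionOfCompleteGraphs {V : Type*} (G : SimpleGraph V) (N : Set ℕ) : Prop :=
  ∀ c : G.ConnectedComponent, ∃ k ∈ N, Nonempty (c.toSimpleGraph ≃g completeGraph (Fin k))

end LocalPath

/-! The core is a vertex version, `localSum_le`: for `s ≥ 2`, give each `s`-clique of `G[U]` the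
weight `1 / binom(β, s - 1)`, where `β` is the largest length of a path of `G[U]` through it. The
total is at most `|U| / s`, with equality only if `G[U]` is a disjoint union of complete graphs of
order at least `s`. The proof is by induction on `U`, using a longest path, with `k` edges. If its
vertices carry a spanning cycle, no edge leaves them, and their cliques weigh at most `binom(k + 1,
s) / binom(k, s - 1) = (k + 1) / s`. Otherwise an endpoint has degree at most `k / 2`, and the
cliques through it weigh at most `2 ^ (1 - s) ≤ 1 / s`.

The edge version takes `s = t - 1` and `U = N(v)`. Prepending `v` to a path in `N(v)` gives `β_G(T)
≥ β_{N(v)}(T \ {v}) + 1`, so the `t`-cliques through `v` weigh at most `deg(v) / (t - 1)`. Summing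
over `v` counts each clique `t` times and each edge twice. Equality makes every neighbourhood a
union of cliques and the inequality for `β` tight, which excludes induced paths on three vertices.
Without `P_{r+1}`, `β_G ≤ r - 1` bounds every weight below, and the bound on the number of cliques
follows. -/

namespace LocalPath

open SimpleGraph

/-! ### Paths as vertex lists -/

variable {V : Type*}

/-- `l` lists the vertices, in order, of a path of `G` inside `U`. -/
def IsPathList (G : SimpleGraph V) (U : Finset V) (l : List V) : Prop :=
  l.Nodup ∧ l.IsChain G.Adj ∧ ∀ x ∈ l, x ∈ U

/-- The lengths of the paths of `G` inside `U` through every vertex of `T`. -/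
def listLengths (G : SimpleGraph V) (U T : Finset V) : Set ℕ :=
  {k | ∃ l, IsPathList G U l ∧ l.length = k + 1 ∧ ∀ x ∈ T, x ∈ l}

/-- The largest length of a path of `G` inside `U` through every vertex of `T`. -/
noncomputable def localBeta (G : SimpleGraph V) (U T : Finset V) : ℕ :=
  sSup (listLengths G U T)

/-- Lists make the later surgery (cutting, reversing, prepending) easy, and the set `U` allows
induction without changing the vertex type. -/
theorem pathLengths_eq [Fintype V] (G : SimpleGraph V) (T : Finset V) :
    pathLengths G T = listLengths G Finset.univ T := by
  ext k
  constructor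
  · rintro ⟨S, hT, ⟨e⟩⟩
    refine ⟨List.ofFn fun i : Fin (k + 1) => (e.symm i : V), ⟨?_, ?_, fun _ _ => Finset.mem_univ _⟩,
      by simp, ?_⟩
    · rw [List.nodup_ofFn]
      exact Subtype.val_injective.comp e.symm.injective
    · rw [List.isChain_iff_getElem]
      intro i hi
      simp only [List.getElem_ofFn]
      have h : S.coe.Adj (e.symm ⟨i, by simp at hi; omega⟩) (e.symm ⟨i + 1, by simpa using hi⟩) := by
        rw [e.symm.map_adj_iff, pathGraph_adj]
        simp
      exact S.adj_sub h
    · intro x hx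
      rw [List.mem_ofFn]
      exact ⟨e ⟨x, hT hx⟩, by simp⟩
  · rintro ⟨l, ⟨hnd, hch, -⟩, hlen, hT⟩
    rw [List.isChain_iff_getElem] at hch
    let f : pathGraph (k + 1) →g G := ⟨fun i => l[i.1]'(by omega), by
      intro a b hab
      rw [pathGraph_adj] at hab
      obtain ⟨a, ha⟩ := a
      obtain ⟨b, hb⟩ := b
      rcases hab with h | h
      · simp only at h
        subst h
        exact hch a (by omega)
      · simp only at h
        subst h
        exact (hch b (by omega)).symm⟩
    have hf : Function.Injective f := by
      intro a b h
      exact Fin.ext ((hnd.getElem_inj_iff).1 h)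
    refine ⟨(Copy.mk f hf).toSubgraph, ?_, ⟨((Copy.mk f hf).isoToSubgraph).symm⟩⟩
    intro x hx
    obtain ⟨i, hi, rfl⟩ := List.getElem_of_mem (hT x hx)
    simp only [Copy.toSubgraph, Subgraph.map_verts]
    exact ⟨⟨i, by omega⟩, trivial, rfl⟩

theorem beta_eq_localBeta [Fintype V] (G : SimpleGraph V) (T : Finset V) :
    beta G T = localBeta G Finset.univ T := by
  rw [beta, localBeta, pathLengths_eq]

theorem IsPathList.length_le {G : SimpleGraph V} {U : Finset V} {l : List V}
    (h : IsPathList G U l) : l.length ≤ U.card := by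
  classical
  rw [← List.toFinset_card_of_nodup h.1]
  exact Finset.card_le_card fun x hx => h.2.2 x (List.mem_toFinset.1 hx)

theorem IsPathList.mono {G : SimpleGraph V} {U W : Finset V} {l : List V}
    (h : IsPathList G U l) (hUW : U ⊆ W) : IsPathList G W l :=
  ⟨h.1, h.2.1, fun x hx => hUW (h.2.2 x hx)⟩

theorem IsPathList.reverse {G : SimpleGraph V} {U : Finset V} {l : List V}
    (h : IsPathList G U l) : IsPathList G U l.reverse := by
  refine ⟨List.nodup_reverse.2 h.1, ?_, by simpa using h.2.2⟩
  rw [List.isChain_reverse]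
  exact h.2.1.imp fun _ _ h => SimpleGraph.Adj.symm h

theorem bddAbove_listLengths (G : SimpleGraph V) (U T : Finset V) :
    BddAbove (listLengths G U T) := by
  refine ⟨U.card, ?_⟩
  rintro k ⟨l, hl, hk, -⟩
  have := hl.length_le
  omega

theorem IsPathList.length_le_localBeta {G : SimpleGraph V} {U T : Finset V} {l : List V}
    (h : IsPathList G U l) (hT : ∀ x ∈ T, x ∈ l) : l.length ≤ localBeta G U T + 1 := by
  rcases Nat.eq_zero_or_pos l.length with h0 | h0
  · omega
  · have : l.length - 1 ≤ localBeta G U T :=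
      le_csSup (bddAbove_listLengths G U T) ⟨l, h, by omega, hT⟩
    omega

theorem isPathList_toList {G : SimpleGraph V} {U T : Finset V} (hc : G.IsClique T) (hT : T ⊆ U) :
    IsPathList G U T.toList := by
  refine ⟨T.nodup_toList, List.Pairwise.isChain ?_, fun x hx => hT (Finset.mem_toList.1 hx)⟩
  refine List.Pairwise.imp_of_mem ?_ T.nodup_toList
  intro a b ha hb hab
  exact hc (by simpa using ha) (by simpa using hb) hab

theorem listLengths_nonempty {G : SimpleGraph V} {U T : Finset V} (hc : G.IsClique T)
    (hT : T ⊆ U) (hne : T.Nonempty) : (listLengths G U T).Nonempty :=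
  ⟨T.card - 1, T.toList, isPathList_toList hc hT, by
    rw [Finset.length_toList]; have := hne.card_pos; omega, by simp⟩

theorem exists_isPathList {G : SimpleGraph V} {U T : Finset V} (h : (listLengths G U T).Nonempty) :
    ∃ l, IsPathList G U l ∧ l.length = localBeta G U T + 1 ∧ ∀ x ∈ T, x ∈ l :=
  Nat.sSup_mem h (bddAbove_listLengths G U T)

theorem card_le_localBeta {G : SimpleGraph V} {U T : Finset V} (hc : G.IsClique T) (hT : T ⊆ U) :
    T.card ≤ localBeta G U T + 1 := by
  simpa using (isPathList_toList hc hT).length_le_localBeta (T := T) (by simp)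

theorem localBeta_mono {G : SimpleGraph V} {U W T : Finset V} (hc : G.IsClique T) (hT : T ⊆ U)
    (hne : T.Nonempty) (hUW : U ⊆ W) : localBeta G U T ≤ localBeta G W T := by
  obtain ⟨l, hl, hlen, hlT⟩ := exists_isPathList (listLengths_nonempty hc hT hne)
  have := (hl.mono hUW).length_le_localBeta hlT
  omega

/-- Passing through `∅` is no constraint, so the maximum is `localBeta G U ∅`. -/
theorem exists_longest (G : SimpleGraph V) {U : Finset V} (hU : U.Nonempty) :
    ∃ (k : ℕ) (l : List V), IsPathList G U l ∧ l.length = k + 1 ∧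
      ∀ l', IsPathList G U l' → l'.length ≤ k + 1 := by
  obtain ⟨v, hv⟩ := hU
  have h : (listLengths G U ∅).Nonempty :=
    ⟨0, [v], ⟨by simp, by simp, by simpa using hv⟩, by simp, by simp⟩
  obtain ⟨l, hl, hlen, -⟩ := exists_isPathList h
  exact ⟨_, l, hl, hlen, fun l' hl' => hl'.length_le_localBeta (by simp)⟩

/-! ### Longest paths: cycle or endpoint of small degree -/

/-- `G[U]` is a disjoint union of complete graphs of order at least `s`. -/
structure IsCliqueUnionOn (G : SimpleGraph V) (U : Finset V) (s : ℕ) : Prop where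
  trans : ∀ a ∈ U, ∀ b ∈ U, ∀ c ∈ U, G.Adj a b → G.Adj b c → a ≠ c → G.Adj a c
  cover : ∀ v ∈ U, ∃ T ⊆ U, G.IsNClique s T ∧ v ∈ T

/-- Inside a vertex set on which adjacency is transitive, the vertices of a path form a clique. -/
theorem IsPathList.pairwise_adj {G : SimpleGraph V} {U : Finset V} {l : List V}
    (h : IsPathList G U l)
    (htr : ∀ a ∈ U, ∀ b ∈ U, ∀ c ∈ U, G.Adj a b → G.Adj b c → a ≠ c → G.Adj a c) :
    ∀ a ∈ l, ∀ b ∈ l, a ≠ b → G.Adj a b := by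
  let R : V → V → Prop := fun a b => a ∈ U ∧ b ∈ U ∧ (a = b ∨ G.Adj a b)
  have : Trans R R R := ⟨by
    rintro a b c ⟨ha, hb, hab⟩ ⟨-, hc, hbc⟩
    refine ⟨ha, hc, ?_⟩
    rcases hab with rfl | hab
    · exact hbc
    rcases hbc with rfl | hbc
    · exact Or.inr hab
    by_cases hac : a = c
    · exact Or.inl hac
    · exact Or.inr (htr a ha b hb c hc hab hbc hac)⟩
  have hch : l.IsChain R := by
    have h1 := h.2.1
    rw [List.isChain_iff_getElem] at h1 ⊢
    exact fun i hi => ⟨h.2.2 _ (List.getElem_mem _), h.2.2 _ (List.getElem_mem _), Or.inr (h1 i hi)⟩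
  have hp : l.Pairwise R := List.isChain_iff_pairwise.1 hch
  intro a ha b hb hab
  have : Std.Symm fun a b => a = b ∨ G.Adj a b :=
    ⟨fun _ _ h => h.imp Eq.symm SimpleGraph.Adj.symm⟩
  have hp2 : l.Pairwise fun a b => a = b ∨ G.Adj a b := hp.imp fun h => h.2.2
  exact (List.Pairwise.forall hp2 ha hb hab).resolve_left hab

/-- The vertex set of a longest path that closes up to a cycle sends no edge to the outside. -/
theorem not_adj_of_cycle {G : SimpleGraph V} {U : Finset V} {c : List V} (hc : IsPathList G U c)
    (hcyc : ∀ x ∈ c.getLast?, ∀ y ∈ c.head?, G.Adj x y)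
    (hmax : ∀ l, IsPathList G U l → l.length ≤ c.length) {x w : V} (hx : x ∈ U) (hxc : x ∉ c)
    (hw : w ∈ c) : ¬ G.Adj x w := by
  intro hxw
  obtain ⟨A, B, rfl⟩ := List.append_of_mem hw
  obtain ⟨hnd, hch, hU⟩ := hc
  rw [List.isChain_append] at hch
  -- Opening the cycle at `w` gives a path from `w` through all its vertices; prepending `x` makes
  -- it too long.
  have : IsPathList G U (x :: ((w :: B) ++ A)) := by
    refine ⟨?_, ?_, ?_⟩
    · rw [List.nodup_cons]
      refine ⟨fun h => hxc ?_, List.nodup_append_comm.1 hnd⟩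
      simp only [List.mem_append] at h ⊢
      tauto
    · rw [List.cons_append, List.isChain_cons_cons, ← List.cons_append, List.isChain_append]
      refine ⟨hxw, hch.2.1, hch.1, ?_⟩
      intro a ha b hb
      apply hcyc a _ b _
      · rw [List.getLast?_append]
        rw [Option.mem_def] at ha
        simp [ha]
      · rw [List.head?_append]
        rw [Option.mem_def] at hb
        simp [hb]
    · intro y hy
      rw [List.mem_cons, List.mem_append] at hy
      rcases hy with rfl | hy | hy
      · exact hx
      · exact hU y (List.mem_append_right _ hy)
      · exact hU y (List.mem_append_left _ hy)
  have := hmax _ this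
  simp at this
  omega

/-- Follow `l` from its start to `l[i]`, jump to `l[k]`, and return backwards to `l[i + 1]`, a
neighbour of the start. For `k = 1` the cycle degenerates to an edge. -/
theorem exists_cycle_of_crossing {G : SimpleGraph V} {U : Finset V} {l : List V} {k i : ℕ}
    (hl : IsPathList G U l) (hlen : l.length = k + 1) (hi : i < k)
    (h0 : G.Adj l[0] l[i + 1]) (hk : G.Adj l[i] l[k]) :
    ∃ c, IsPathList G U c ∧ c.Perm l ∧ ∀ x ∈ c.getLast?, ∀ y ∈ c.head?, G.Adj x y := by
  obtain ⟨hnd, hch, hU⟩ := hl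
  have hperm : (l.take (i + 1) ++ (l.drop (i + 1)).reverse).Perm l := by
    conv_rhs => rw [← List.take_append_drop (i + 1) l]
    exact (List.reverse_perm _).append_left _
  refine ⟨_, ⟨hperm.nodup_iff.2 hnd, ?_, fun x hx => hU x (hperm.subset hx)⟩, hperm, ?_⟩
  · rw [List.isChain_append]
    refine ⟨hch.take _, ?_, ?_⟩
    · rw [List.isChain_reverse]
      exact (hch.drop _).imp fun _ _ h => SimpleGraph.Adj.symm h
    · intro a ha b hb
      rw [List.head?_reverse, List.getLast?_drop] at hb
      rw [List.getLast?_take] at ha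
      simp [List.getLast?_eq_getElem?, hlen, show ¬ (k + 1 ≤ i + 1) by omega] at ha hb
      obtain ⟨-, rfl⟩ := hb
      rw [List.getElem?_eq_getElem (by omega)] at ha
      simp at ha
      subst ha
      exact hk
  · intro a ha b hb
    have hne : l.drop (i + 1) ≠ [] := by
      rw [Ne, List.drop_eq_nil_iff]; omega
    rw [List.getLast?_append, List.getLast?_reverse, List.head?_drop,
      List.getElem?_eq_getElem (by omega)] at ha
    rw [List.head?_append, List.head?_take, List.head?_eq_getElem?,
      List.getElem?_eq_getElem (by omega)] at hb
    simp at ha hb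
    subst ha hb
    exact h0.symm

/-- All neighbours of the first vertex of a longest path lie on the path. -/
theorem mem_of_adj_head {G : SimpleGraph V} {U : Finset V} {l : List V} {k : ℕ}
    (hl : IsPathList G U l) (hlen : l.length = k + 1)
    (hmax : ∀ l', IsPathList G U l' → l'.length ≤ k + 1) {x : V} (hx : x ∈ U)
    (h : G.Adj l[0] x) : x ∈ l := by
  by_contra hxl
  have h1 : IsPathList G U (x :: l) := by
    refine ⟨List.nodup_cons.2 ⟨hxl, hl.1⟩, ?_, ?_⟩
    · rw [List.isChain_cons]
      refine ⟨?_, hl.2.1⟩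
      intro y hy
      rw [List.head?_eq_getElem?, List.getElem?_eq_getElem (by omega)] at hy
      simp at hy
      subst hy
      exact h.symm
    · intro y hy
      rcases List.mem_cons.1 hy with rfl | hy
      · exact hx
      · exact hl.2.2 y hy
  have := hmax _ h1
  simp at this
  omega

/-- Without a crossing pair, the predecessors on the path of the neighbours of `l[0]` are disjoint
from the neighbours of `l[k]`. Both sets sit among `k` positions, so one endpoint has degree at most
`k / 2`. -/
theorem exists_cycle_or_small_degree [DecidableEq V] (G : SimpleGraph V) [DecidableRel G.Adj]
    {U : Finset V} {l : List V} {k : ℕ}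
    (hl : IsPathList G U l) (hlen : l.length = k + 1)
    (hmax : ∀ l', IsPathList G U l' → l'.length ≤ k + 1) :
    (∃ c, IsPathList G U c ∧ c.length = k + 1 ∧
      ∀ x ∈ c.getLast?, ∀ y ∈ c.head?, G.Adj x y) ∨
    ∃ l' v, IsPathList G U l' ∧ l'.length = k + 1 ∧ v ∈ l' ∧ (∀ x ∈ U, G.Adj v x → x ∈ l') ∧
      2 * (U.filter (G.Adj v)).card ≤ k := by
  by_cases hcr : ∃ (i : ℕ) (hi : i < k), G.Adj l[0] l[i + 1] ∧ G.Adj l[i] l[k]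
  · obtain ⟨i, hi, h0, hk⟩ := hcr
    obtain ⟨c, hc, hp, hcyc⟩ := exists_cycle_of_crossing hl hlen hi h0 hk
    exact Or.inl ⟨c, hc, by rw [hp.length_eq, hlen], hcyc⟩
  right
  have hN0 : ∀ x ∈ U, G.Adj l[0] x → x ∈ l := fun x hx h => mem_of_adj_head hl hlen hmax hx h
  have hNk : ∀ x ∈ U, G.Adj l[k] x → x ∈ l := by
    intro x hx h
    rw [← List.mem_reverse]
    refine mem_of_adj_head hl.reverse (by simpa using hlen) hmax hx ?_
    rw [List.getElem_reverse]
    simpa [hlen] using h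
  -- The default `l[0]` is never reached: only indices up to `k` occur.
  let f : ℕ → V := fun i => l.getD i l[0]
  have hf : ∀ (i : ℕ) (hi : i ≤ k), f i = l[i] := fun i hi => by
    simp only [f]
    rw [List.getD_eq_getElem _ _ (by omega)]
  let A := (Finset.range k).filter fun i => G.Adj l[0] (f (i + 1))
  let B := (Finset.range k).filter fun i => G.Adj l[k] (f i)
  have hAB : Disjoint A B := by
    rw [Finset.disjoint_left]
    intro i hA hB
    simp only [A, B, Finset.mem_filter, Finset.mem_range] at hA hB
    refine hcr ⟨i, hA.1, ?_, ?_⟩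
    · rw [← hf (i + 1) (by omega)]; exact hA.2
    · rw [← hf i (by omega)]; exact hB.2.symm
  have hcard : A.card + B.card ≤ k := by
    rw [← Finset.card_union_of_disjoint hAB]
    have : A ∪ B ⊆ Finset.range k :=
      Finset.union_subset (Finset.filter_subset _ _) (Finset.filter_subset _ _)
    simpa using Finset.card_le_card this
  have hdA : (U.filter (G.Adj l[0])).card ≤ A.card := by
    refine le_trans (Finset.card_le_card ?_) (Finset.card_image_le (f := fun i => f (i + 1)))
    intro x hx
    rw [Finset.mem_filter] at hx
    obtain ⟨i, hi, rfl⟩ := List.getElem_of_mem (hN0 x hx.1 hx.2)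
    rcases i with _ | i
    · exact absurd hx.2 (G.loopless.irrefl _)
    · refine Finset.mem_image.2 ⟨i, ?_, hf _ (by omega)⟩
      simp only [A, Finset.mem_filter, Finset.mem_range]
      refine ⟨by omega, ?_⟩
      rw [hf _ (by omega)]
      exact hx.2
  have hdB : (U.filter (G.Adj l[k])).card ≤ B.card := by
    refine le_trans (Finset.card_le_card ?_) (Finset.card_image_le (f := f))
    intro x hx
    rw [Finset.mem_filter] at hx
    obtain ⟨i, hi, rfl⟩ := List.getElem_of_mem (hNk x hx.1 hx.2)
    have hik : i ≠ k := by
      rintro rfl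
      exact G.loopless.irrefl _ hx.2
    refine Finset.mem_image.2 ⟨i, ?_, hf _ (by omega)⟩
    simp only [B, Finset.mem_filter, Finset.mem_range]
    refine ⟨by omega, ?_⟩
    rw [hf _ (by omega)]
    exact hx.2
  rcases le_total (U.filter (G.Adj l[0])).card (U.filter (G.Adj l[k])).card with h | h
  · exact ⟨l, l[0], hl, hlen, List.getElem_mem _, hN0, by omega⟩
  · exact ⟨l, l[k], hl, hlen, List.getElem_mem _, hNk, by omega⟩

/-! ### Clique counts and binomial estimates -/

/-- The cliques of order `s` of `G` inside `U`. -/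
def cliquesIn [DecidableEq V] (G : SimpleGraph V) [DecidableRel G.Adj] (U : Finset V) (s : ℕ) :
    Finset (Finset V) :=
  (U.powersetCard s).filter fun T => G.IsClique (T : Set V)

section

variable [DecidableEq V] {G : SimpleGraph V} [DecidableRel G.Adj] {U W T : Finset V} {s : ℕ}

theorem mem_cliquesIn : T ∈ cliquesIn G U s ↔ T ⊆ U ∧ T.card = s ∧ G.IsClique (T : Set V) := by
  rw [cliquesIn, Finset.mem_filter, Finset.mem_powersetCard, and_assoc]

theorem choose_localBeta_pos (hT : T ∈ cliquesIn G U s) :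
    0 < (localBeta G U T).choose (s - 1) := by
  rw [mem_cliquesIn] at hT
  have := card_le_localBeta hT.2.2 hT.1
  exact Nat.choose_pos (by omega)

theorem localWeight_anti (hs : 1 ≤ s) (hT : T ∈ cliquesIn G U s) (hUW : U ⊆ W) :
    (1 : ℝ) / ((localBeta G W T).choose (s - 1) : ℝ) ≤
      1 / ((localBeta G U T).choose (s - 1) : ℝ) := by
  have hpos := choose_localBeta_pos hT
  rw [mem_cliquesIn] at hT
  have hne : T.Nonempty := by rw [← Finset.card_pos]; omega
  apply one_div_le_one_div_of_le (by exact_mod_cast hpos)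
  exact_mod_cast Nat.choose_le_choose _ (localBeta_mono hT.2.2 hT.1 hne hUW)

theorem card_cliquesIn_mem_le (v : V) :
    ((cliquesIn G U s).filter fun T => v ∈ T).card ≤
      ((U.filter (G.Adj v)).card).choose (s - 1) := by
  rw [← Finset.card_powersetCard]
  refine Finset.card_le_card_of_injOn (fun T => T.erase v) ?_ ?_
  · intro T hT
    simp only [Finset.coe_filter, Set.mem_ofPred_eq, mem_cliquesIn] at hT
    obtain ⟨⟨hTU, hcard, hcl⟩, hv⟩ := hT
    rw [Finset.mem_coe, Finset.mem_powersetCard]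
    refine ⟨?_, by rw [Finset.card_erase_of_mem hv, hcard]⟩
    intro x hx
    rw [Finset.mem_erase] at hx
    exact Finset.mem_filter.2 ⟨hTU hx.2, hcl hv hx.2 (Ne.symm hx.1)⟩
  · intro T hT T' hT' h
    simp only [Finset.coe_filter, Set.mem_ofPred_eq] at hT hT'
    have h : T.erase v = T'.erase v := h
    rw [← Finset.insert_erase hT.2, h, Finset.insert_erase hT'.2]

end

/-- By Pascal's rule, the step from `a` to `a + 1` adds `a.choose (j - 1)`, which is positive since
`j ≤ a + 1`. -/
theorem choose_lt_choose_left {a b j : ℕ} (hj : 1 ≤ j) (hja : j ≤ a + 1) (hab : a < b) :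
    a.choose j < b.choose j := by
  refine lt_of_lt_of_le ?_ (Nat.choose_le_choose j (Nat.succ_le_of_lt hab))
  obtain ⟨j, rfl⟩ := Nat.exists_eq_add_of_le' hj
  rw [Nat.succ_eq_add_one, Nat.choose_succ_succ']
  have : 0 < a.choose j := Nat.choose_pos (by omega)
  omega

/-- Factor by factor: `2 * (d - j) ≤ k - j`, also with truncated subtraction. -/
theorem two_pow_mul_descFactorial_le {d k : ℕ} (h : 2 * d ≤ k) (j : ℕ) :
    2 ^ j * d.descFactorial j ≤ k.descFactorial j := by
  induction j with
  | zero => simp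
  | succ j ih =>
    rw [Nat.descFactorial_succ, Nat.descFactorial_succ]
    calc 2 ^ (j + 1) * ((d - j) * d.descFactorial j)
        = (2 * (d - j)) * (2 ^ j * d.descFactorial j) := by ring
      _ ≤ (k - j) * k.descFactorial j := Nat.mul_le_mul (by omega) ih

theorem mul_choose_le_choose {d k s : ℕ} (h : 2 * d ≤ k) (hs : 1 ≤ s) :
    s * d.choose (s - 1) ≤ k.choose (s - 1) := by
  have h1 := two_pow_mul_descFactorial_le h (s - 1)
  rw [Nat.descFactorial_eq_factorial_mul_choose, Nat.descFactorial_eq_factorial_mul_choose] at h1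
  have h2 : 2 ^ (s - 1) * d.choose (s - 1) ≤ k.choose (s - 1) := by
    apply Nat.le_of_mul_le_mul_left _ (Nat.factorial_pos (s - 1))
    calc _ = 2 ^ (s - 1) * ((s - 1).factorial * d.choose (s - 1)) := by ring
      _ ≤ _ := h1
  refine le_trans (Nat.mul_le_mul_right _ ?_) h2
  have := Nat.lt_two_pow_self (n := s - 1)
  omega

/-- The bound for a Hamiltonian component on `k + 1` vertices. -/
theorem div_choose_le {N k s : ℕ} (hs : 1 ≤ s) (hN : N ≤ (k + 1).choose s) :
    (N : ℝ) / (k.choose (s - 1) : ℝ) ≤ ((k + 1 : ℕ) : ℝ) / s ∧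
      ((N : ℝ) / (k.choose (s - 1) : ℝ) = ((k + 1 : ℕ) : ℝ) / s →
        N = (k + 1).choose s ∧ s ≤ k + 1) := by
  have hs0 : (0 : ℝ) < s := by exact_mod_cast hs
  rcases Nat.eq_zero_or_pos (k.choose (s - 1)) with h0 | h0
  -- Here `k + 1 < s`: the quotient is `0` by the convention for division by zero, so equality
  -- fails.
  · have hpos : (0 : ℝ) < ((k + 1 : ℕ) : ℝ) / s := by positivity
    rw [h0]
    simp only [Nat.cast_zero, div_zero]
    exact ⟨hpos.le, fun h => absurd h hpos.ne⟩
  · have hc : (0 : ℝ) < (k.choose (s - 1) : ℝ) := by exact_mod_cast h0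
    have hid : (k + 1) * k.choose (s - 1) = (k + 1).choose s * s := by
      have := Nat.add_one_mul_choose_eq k (s - 1)
      rwa [Nat.sub_add_cancel hs] at this
    constructor
    · rw [div_le_div_iff₀ hc hs0]
      have : N * s ≤ (k + 1) * k.choose (s - 1) := hid ▸ Nat.mul_le_mul_right s hN
      exact_mod_cast this
    · intro h
      rw [div_eq_div_iff hc.ne' hs0.ne'] at h
      have h : N * s = (k + 1) * k.choose (s - 1) := by exact_mod_cast h
      rw [hid] at h
      refine ⟨Nat.eq_of_mul_eq_mul_right hs h, ?_⟩
      by_contra hlt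
      rw [Nat.choose_eq_zero_of_lt (by omega)] at h0
      exact absurd h0 (lt_irrefl _)

/-! ### The vertex-localized bound -/

section

variable [DecidableEq V] {G : SimpleGraph V} [DecidableRel G.Adj] {U : Finset V} {s : ℕ}

/-- The vertex-localized weight of the cliques of order `s` inside `U`. -/
noncomputable def localSum (G : SimpleGraph V) [DecidableRel G.Adj] (U : Finset V) (s : ℕ) : ℝ :=
  ∑ T ∈ cliquesIn G U s, 1 / ((localBeta G U T).choose (s - 1) : ℝ)

/-- No edge leaves the cycle, so each clique lies inside it, where `localBeta` is `k`, or in the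
rest, where induction applies. Equality forces every `s`-subset of the cycle to be a clique; as `2 ≤
s`, every pair lies in such a subset. -/
theorem localSum_of_cycle {c : List V} {k : ℕ} (hs : 2 ≤ s) (hc : IsPathList G U c)
    (hlen : c.length = k + 1) (hcyc : ∀ x ∈ c.getLast?, ∀ y ∈ c.head?, G.Adj x y)
    (hmax : ∀ l, IsPathList G U l → l.length ≤ k + 1)
    (ih : localSum G (U \ c.toFinset) s ≤ ((U \ c.toFinset).card : ℝ) / s ∧
      (localSum G (U \ c.toFinset) s = ((U \ c.toFinset).card : ℝ) / s →
        IsCliqueUnionOn G (U \ c.toFinset) s)) :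
    localSum G U s ≤ (U.card : ℝ) / s ∧
      (localSum G U s = (U.card : ℝ) / s → IsCliqueUnionOn G U s) := by
  set C := c.toFinset with hC
  have hCU : C ⊆ U := fun x hx => hc.2.2 x (List.mem_toFinset.1 hx)
  have hCcard : C.card = k + 1 := by rw [hC, List.toFinset_card_of_nodup hc.1, hlen]
  have hout : ∀ x ∈ U, x ∉ C → ∀ w ∈ C, ¬ G.Adj x w := by
    intro x hx hxC w hw
    exact not_adj_of_cycle hc hcyc (by rw [hlen]; exact hmax) hx (by simpa [hC] using hxC)
      (by simpa [hC] using hw)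
  have hin : (cliquesIn G U s).filter (fun T => T ⊆ C) = cliquesIn G C s := by
    ext T
    rw [Finset.mem_filter, mem_cliquesIn, mem_cliquesIn]
    exact ⟨fun h => ⟨h.2, h.1.2⟩, fun h => ⟨⟨h.1.trans hCU, h.2⟩, h.1⟩⟩
  have hnotin : (cliquesIn G U s).filter (fun T => ¬ T ⊆ C) = cliquesIn G (U \ C) s := by
    ext T
    rw [Finset.mem_filter, mem_cliquesIn, mem_cliquesIn]
    constructor
    · rintro ⟨⟨hTU, hcard, hcl⟩, hTC⟩
      refine ⟨?_, hcard, hcl⟩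
      obtain ⟨x, hxT, hxC⟩ := Finset.not_subset.1 hTC
      intro y hy
      rw [Finset.mem_sdiff]
      refine ⟨hTU hy, fun hyC => ?_⟩
      have hxy : x ≠ y := fun h => hxC (h ▸ hyC)
      exact hout x (hTU hxT) hxC y hyC (hcl hxT hy hxy)
    · rintro ⟨hTU, hcard, hcl⟩
      refine ⟨⟨hTU.trans Finset.sdiff_subset, hcard, hcl⟩, fun hTC => ?_⟩
      obtain ⟨x, hx⟩ : T.Nonempty := by rw [← Finset.card_pos]; omega
      exact (Finset.mem_sdiff.1 (hTU hx)).2 (hTC hx)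
  have hbeta : ∀ T ∈ cliquesIn G C s, localBeta G U T = k := by
    intro T hT
    rw [mem_cliquesIn] at hT
    have h1 := hc.length_le_localBeta (T := T) fun x hx => List.mem_toFinset.1 (hT.1 hx)
    obtain ⟨l, hl, hl1, -⟩ := exists_isPathList (U := U) (T := T)
      (listLengths_nonempty hT.2.2 (hT.1.trans hCU) (by rw [← Finset.card_pos]; omega))
    have h2 := hmax l hl
    omega
  have hsplit : localSum G U s =
      ((cliquesIn G C s).card : ℝ) / (k.choose (s - 1) : ℝ) +
        ∑ T ∈ cliquesIn G (U \ C) s, 1 / ((localBeta G U T).choose (s - 1) : ℝ) := by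
    rw [localSum, ← Finset.sum_filter_add_sum_filter_not _ (fun T => T ⊆ C), hin, hnotin]
    congr 1
    rw [Finset.sum_congr rfl fun T hT => by rw [hbeta T hT], Finset.sum_const, nsmul_eq_mul,
      mul_one_div]
  have hrest : ∑ T ∈ cliquesIn G (U \ C) s, 1 / ((localBeta G U T).choose (s - 1) : ℝ) ≤
      localSum G (U \ C) s :=
    Finset.sum_le_sum fun T hT => localWeight_anti (by omega) hT Finset.sdiff_subset
  have hN : (cliquesIn G C s).card ≤ (k + 1).choose s := by
    rw [← hCcard, ← Finset.card_powersetCard]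
    exact Finset.card_filter_le _ _
  obtain ⟨hle, heq⟩ := div_choose_le (by omega) hN
  have hcardU : (U.card : ℝ) / s = ((k + 1 : ℕ) : ℝ) / s + ((U \ C).card : ℝ) / s := by
    rw [← add_div, ← hCcard, ← Nat.cast_add, add_comm, Finset.card_sdiff_add_card_eq_card hCU]
  rw [hsplit, hcardU]
  refine ⟨by linarith [ih.1], fun h => ?_⟩
  obtain ⟨hNeq, hsk⟩ := heq (by linarith [ih.1])
  have hD := ih.2 (by linarith [ih.1])
  have hall : ∀ T ⊆ C, T.card = s → G.IsClique (T : Set V) := by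
    rw [← hCcard, ← Finset.card_powersetCard] at hNeq
    intro T hT hTs
    have := (Finset.card_filter_eq_iff.1 hNeq) T (Finset.mem_powersetCard.2 ⟨hT, hTs⟩)
    exact this
  have hCadj : ∀ a ∈ C, ∀ b ∈ C, a ≠ b → G.Adj a b := by
    intro a ha b hb hab
    obtain ⟨T, hT1, hT2, hT3⟩ := Finset.exists_subsuperset_card_eq (s := {a, b}) (t := C) (n := s)
      (by intro x hx; rw [Finset.mem_insert, Finset.mem_singleton] at hx
          rcases hx with rfl | rfl <;> assumption)
      (by rw [Finset.card_pair hab]; exact hs) (by omega)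
    exact hall T hT2 hT3 (hT1 (by simp)) (hT1 (by simp)) hab
  constructor
  · intro a ha b hb c' hc' hab hbc hac
    by_cases hbC : b ∈ C
    · have haC : a ∈ C := by
        by_contra h; exact hout a ha h b hbC hab
      have hcC : c' ∈ C := by
        by_contra h; exact hout c' hc' h b hbC hbc.symm
      exact hCadj a haC c' hcC hac
    · have haC : a ∉ C := fun h => hout b hb hbC a h hab.symm
      have hcC : c' ∉ C := fun h => hout b hb hbC c' h hbc
      exact hD.trans a (Finset.mem_sdiff.2 ⟨ha, haC⟩) b (Finset.mem_sdiff.2 ⟨hb, hbC⟩) c'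
        (Finset.mem_sdiff.2 ⟨hc', hcC⟩) hab hbc hac
  · intro v hv
    by_cases hvC : v ∈ C
    · obtain ⟨T, hT1, hT2, hT3⟩ := Finset.exists_subsuperset_card_eq (s := {v}) (t := C) (n := s)
        (by simpa using hvC) (by simp; omega) (by omega)
      exact ⟨T, hT2.trans hCU, ⟨hall T hT2 hT3, hT3⟩, hT1 (by simp)⟩
    · obtain ⟨T, hT1, hT2⟩ := hD.cover v (Finset.mem_sdiff.2 ⟨hv, hvC⟩)
      exact ⟨T, hT1.trans Finset.sdiff_subset, hT2⟩

/-- Attaching a vertex to a disjoint union of complete graphs lengthens a path. -/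
theorem exists_localBeta_lt {v w : V} (hv : v ∈ U) (hw : w ∈ U) (hvw : G.Adj v w)
    (hD : IsCliqueUnionOn G (U.erase v) s) :
    ∃ T ∈ cliquesIn G (U.erase v) s, localBeta G (U.erase v) T < localBeta G U T := by
  obtain ⟨T, hTU, hT, hwT⟩ := hD.cover w (Finset.mem_erase.2 ⟨hvw.ne', hw⟩)
  refine ⟨T, mem_cliquesIn.2 ⟨hTU, hT.card_eq, hT.isClique⟩, ?_⟩
  obtain ⟨l, hl, hlen, hTl⟩ := exists_isPathList (U := U.erase v) (T := T)
    (listLengths_nonempty hT.isClique hTU ⟨w, hwT⟩)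
  have hadj := hl.pairwise_adj hD.trans
  have hwl := hTl w hwT
  -- By transitivity the vertices of `l` form a clique, so they may be reordered to start at `w`,
  -- ready to be preceded by `v`.
  have hp : l.Perm (w :: l.erase w) := List.perm_cons_erase hwl
  have hnd : (w :: l.erase w).Nodup := hp.nodup_iff.1 hl.1
  have hvl : v ∉ w :: l.erase w := fun h =>
    Finset.notMem_erase v U (hl.2.2 v (hp.symm.subset h))
  have hpath : IsPathList G U (v :: w :: l.erase w) := by
    refine ⟨List.nodup_cons.2 ⟨hvl, hnd⟩, ?_, ?_⟩
    · rw [List.isChain_cons_cons]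
      refine ⟨hvw, List.Pairwise.isChain (List.Pairwise.imp_of_mem ?_ hnd)⟩
      intro a b ha hb hab
      exact hadj a (hp.symm.subset ha) b (hp.symm.subset hb) hab
    · intro x hx
      rcases List.mem_cons.1 hx with rfl | hx
      · exact hv
      · exact Finset.erase_subset _ _ (hl.2.2 x (hp.symm.subset hx))
  have h1 := hpath.length_le_localBeta (T := T) fun x hx =>
    List.mem_cons_of_mem _ (hp.subset (hTl x hx))
  rw [List.length_cons, ← hp.length_eq, hlen] at h1
  omega

/-- A clique through `v` lies on the longest path, so its `localBeta` is `k`; such cliques together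
cost at most `1 / s`, the share of the deleted vertex. -/
theorem localSum_of_small_degree {l : List V} {k : ℕ} {v : V} (hs : 2 ≤ s) (hl : IsPathList G U l)
    (hlen : l.length = k + 1) (hv : v ∈ l) (hN : ∀ x ∈ U, G.Adj v x → x ∈ l)
    (hmax : ∀ l, IsPathList G U l → l.length ≤ k + 1)
    (hd : 2 * (U.filter (G.Adj v)).card ≤ k)
    (ih : localSum G (U.erase v) s ≤ ((U.erase v).card : ℝ) / s ∧
      (localSum G (U.erase v) s = ((U.erase v).card : ℝ) / s →
        IsCliqueUnionOn G (U.erase v) s)) :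
    localSum G U s ≤ (U.card : ℝ) / s ∧
      (localSum G U s = (U.card : ℝ) / s → IsCliqueUnionOn G U s) := by
  have hs0 : (0 : ℝ) < s := by exact_mod_cast (by omega : 0 < s)
  have hvU : v ∈ U := hl.2.2 v hv
  have hnotin : (cliquesIn G U s).filter (fun T => ¬ v ∈ T) = cliquesIn G (U.erase v) s := by
    ext T
    rw [Finset.mem_filter, mem_cliquesIn, mem_cliquesIn, Finset.subset_erase]
    tauto
  have hbeta : ∀ T ∈ (cliquesIn G U s).filter (fun T => v ∈ T), localBeta G U T = k := by
    intro T hT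
    rw [Finset.mem_filter, mem_cliquesIn] at hT
    obtain ⟨⟨hTU, hcard, hcl⟩, hvT⟩ := hT
    have h1 := hl.length_le_localBeta (T := T) fun x hx => by
      by_cases hxv : x = v
      · exact hxv ▸ hv
      · exact hN x (hTU hx) (hcl hvT hx (Ne.symm hxv))
    obtain ⟨l', hl', hl1, -⟩ := exists_isPathList (U := U) (T := T)
      (listLengths_nonempty hcl hTU ⟨v, hvT⟩)
    have h2 := hmax l' hl'
    omega
  set N := ((cliquesIn G U s).filter (fun T => v ∈ T)).card with hNdef
  have hsplit : localSum G U s =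
      (N : ℝ) / (k.choose (s - 1) : ℝ) +
        ∑ T ∈ cliquesIn G (U.erase v) s, 1 / ((localBeta G U T).choose (s - 1) : ℝ) := by
    rw [localSum, ← Finset.sum_filter_add_sum_filter_not _ (fun T => v ∈ T), hnotin]
    congr 1
    rw [Finset.sum_congr rfl fun T hT => by rw [hbeta T hT], Finset.sum_const, nsmul_eq_mul,
      mul_one_div]
  have hanti : ∀ T ∈ cliquesIn G (U.erase v) s,
      (1 : ℝ) / ((localBeta G U T).choose (s - 1) : ℝ) ≤
        1 / ((localBeta G (U.erase v) T).choose (s - 1) : ℝ) := fun T hT =>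
    localWeight_anti (by omega) hT (Finset.erase_subset _ _)
  have hrest : ∑ T ∈ cliquesIn G (U.erase v) s, 1 / ((localBeta G U T).choose (s - 1) : ℝ) ≤
      localSum G (U.erase v) s := Finset.sum_le_sum hanti
  have hNd : N ≤ ((U.filter (G.Adj v)).card).choose (s - 1) := card_cliquesIn_mem_le v
  have hNk : s * N ≤ k.choose (s - 1) :=
    (Nat.mul_le_mul_left s hNd).trans (mul_choose_le_choose hd (by omega))
  have hfirst : (N : ℝ) / (k.choose (s - 1) : ℝ) ≤ 1 / s := by
    rcases Nat.eq_zero_or_pos (k.choose (s - 1)) with h0 | h0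
    · rw [h0, Nat.cast_zero, div_zero]; positivity
    · rw [div_le_div_iff₀ (by exact_mod_cast h0) hs0]
      have : N * s ≤ 1 * k.choose (s - 1) := by linarith
      exact_mod_cast this
  have hcardU : (U.card : ℝ) / s = 1 / s + ((U.erase v).card : ℝ) / s := by
    rw [← add_div, ← Finset.card_erase_add_one hvU, Nat.cast_add, Nat.cast_one, add_comm]
  rw [hsplit, hcardU]
  refine ⟨by linarith [ih.1], fun h => ?_⟩
  -- For `s = 2` the numerical estimate can be tight. Equality still fails: if `v` has a neighbour,
  -- restoring `v` lengthens the best path through some clique, and if not, no clique contains `v`.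
  exfalso
  have hD := ih.2 (by linarith [ih.1])
  have hsum : ∑ T ∈ cliquesIn G (U.erase v) s, 1 / ((localBeta G U T).choose (s - 1) : ℝ) =
      localSum G (U.erase v) s := by linarith [ih.1]
  have hfirst' : (N : ℝ) / (k.choose (s - 1) : ℝ) = 1 / s := by linarith [ih.1]
  rcases (U.filter (G.Adj v)).eq_empty_or_nonempty with hemp | ⟨w, hw⟩
  · rw [hemp, Finset.card_empty, Nat.choose_eq_zero_of_lt (by omega)] at hNd
    rw [Nat.le_zero.1 hNd, Nat.cast_zero, zero_div] at hfirst'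
    exact (one_div_pos.2 hs0).ne hfirst'
  · rw [Finset.mem_filter] at hw
    obtain ⟨T, hT, hlt⟩ := exists_localBeta_lt hvU hw.1 hw.2 hD
    have heq := (Finset.sum_eq_sum_iff_of_le hanti).1 hsum T hT
    have hpos := choose_localBeta_pos hT
    have hTs := card_le_localBeta (mem_cliquesIn.1 hT).2.2 (mem_cliquesIn.1 hT).1
    rw [(mem_cliquesIn.1 hT).2.1] at hTs
    rw [one_div, one_div, inv_inj, Nat.cast_inj] at heq
    exact (choose_lt_choose_left (by omega) (by omega) hlt).ne' heq

theorem localSum_le (hs : 2 ≤ s) (U : Finset V) :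
    localSum G U s ≤ (U.card : ℝ) / s ∧
      (localSum G U s = (U.card : ℝ) / s → IsCliqueUnionOn G U s) := by
  induction U using Finset.strongInduction with
  | H U ih =>
    rcases U.eq_empty_or_nonempty with rfl | hU
    · have : cliquesIn G (∅ : Finset V) s = ∅ := by
        rw [cliquesIn, Finset.powersetCard_eq_empty.2 (by simp; omega), Finset.filter_empty]
      refine ⟨by simp [localSum, this], fun _ => ⟨by simp, by simp⟩⟩
    · obtain ⟨k, l, hl, hlen, hmax⟩ := exists_longest G hU
      rcases exists_cycle_or_small_degree G hl hlen hmax with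
        ⟨c, hc, hclen, hcyc⟩ | ⟨l', v, hl', hlen', hv, hN, hd⟩
      · refine localSum_of_cycle hs hc hclen hcyc hmax (ih _ ?_)
        refine Finset.sdiff_ssubset (fun x hx => hc.2.2 x (List.mem_toFinset.1 hx)) ?_
        rw [List.toFinset_nonempty_iff]
        rintro rfl
        simp at hclen
      · exact localSum_of_small_degree hs hl' hlen' hv hN hmax hd
          (ih _ (Finset.erase_ssubset (hl'.2.2 v hv)))

end

/-! ### From neighbourhoods to edges -/

theorem weightFun_strictAntiOn {t : ℕ} (ht : 3 ≤ t) :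
    StrictAntiOn (weightFun t) (Set.Ici (t - 1)) := by
  intro a ha b hb hab
  rw [Set.mem_Ici] at ha hb
  refine one_div_lt_one_div_of_lt ?_ ?_
  · exact_mod_cast Nat.choose_pos (by omega)
  · exact_mod_cast choose_lt_choose_left (by omega) (by omega) (by omega)

section

variable [Fintype V] [DecidableEq V] {G : SimpleGraph V} [DecidableRel G.Adj]
  {t m r : ℕ} {T : Finset V} {v : V}

theorem isGreatest_beta (ht : 1 ≤ t) (hT : T ∈ G.cliqueFinset t) :
    IsGreatest (pathLengths G T) (beta G T) := by
  rw [mem_cliqueFinset_iff] at hT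
  rw [beta, pathLengths_eq]
  have hb := bddAbove_listLengths G Finset.univ T
  have hne : T.Nonempty := by rw [← Finset.card_pos, hT.card_eq]; omega
  exact ⟨Nat.sSup_mem (listLengths_nonempty hT.isClique (Finset.subset_univ _) hne) hb,
    fun k hk => le_csSup hb hk⟩

theorem le_beta (hT : T ∈ G.cliqueFinset t) : t - 1 ≤ beta G T := by
  rw [mem_cliqueFinset_iff] at hT
  have := card_le_localBeta hT.isClique (Finset.subset_univ T)
  rw [hT.card_eq] at this
  rw [beta_eq_localBeta]
  omega

theorem erase_mem_cliquesIn (hT : T ∈ G.cliqueFinset t) (hv : v ∈ T) :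
    T.erase v ∈ cliquesIn G (G.neighborFinset v) (t - 1) := by
  rw [mem_cliqueFinset_iff] at hT
  rw [mem_cliquesIn, Finset.card_erase_of_mem hv, hT.card_eq]
  refine ⟨fun x hx => ?_, rfl, hT.isClique.subset (Finset.erase_subset _ _)⟩
  rw [Finset.mem_erase] at hx
  rw [mem_neighborFinset]
  exact hT.isClique hv hx.2 (Ne.symm hx.1)

theorem insert_mem_cliqueFinset (ht : 1 ≤ t)
    (hT : T ∈ cliquesIn G (G.neighborFinset v) (t - 1)) :
    insert v T ∈ G.cliqueFinset t ∧ v ∉ T := by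
  rw [mem_cliquesIn] at hT
  obtain ⟨hTN, hcard, hcl⟩ := hT
  have hv : v ∉ T := fun h => by simpa using hTN h
  refine ⟨?_, hv⟩
  rw [mem_cliqueFinset_iff]
  have := IsNClique.insert (n := t - 1) (s := T) (a := v) ⟨hcl, hcard⟩ fun b hb => by
    simpa using hTN hb
  rwa [Nat.sub_add_cancel ht] at this

theorem sum_cliques_through (ht : 1 ≤ t) (v : V) (g : Finset V → ℝ) :
    ∑ T ∈ (G.cliqueFinset t).filter (fun T => v ∈ T), g (T.erase v) =
      ∑ S ∈ cliquesIn G (G.neighborFinset v) (t - 1), g S := by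
  refine Finset.sum_bij' (fun T _ => T.erase v) (fun S _ => insert v S) ?_ ?_ ?_ ?_ ?_
  · intro T hT
    rw [Finset.mem_filter] at hT
    exact erase_mem_cliquesIn hT.1 hT.2
  · intro S hS
    exact Finset.mem_filter.2 ⟨(insert_mem_cliqueFinset ht hS).1, Finset.mem_insert_self _ _⟩
  · intro T hT
    exact Finset.insert_erase (Finset.mem_filter.1 hT).2
  · intro S hS
    exact Finset.erase_insert (insert_mem_cliqueFinset ht hS).2
  · intro T _
    rfl

theorem sum_sum_cliques_through (f : Finset V → ℝ) :
    ∑ v, ∑ T ∈ (G.cliqueFinset t).filter (fun T => v ∈ T), f T =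
      t * ∑ T ∈ G.cliqueFinset t, f T := by
  simp_rw [Finset.sum_filter]
  rw [Finset.sum_comm, Finset.mul_sum]
  refine Finset.sum_congr rfl fun T hT => ?_
  rw [← Finset.sum_filter, Finset.sum_const, nsmul_eq_mul, Finset.filter_univ_mem,
    (mem_cliqueFinset_iff.1 hT).card_eq]

theorem IsPathList.cons_neighbor {l : List V} (hl : IsPathList G (G.neighborFinset v) l) :
    IsPathList G Finset.univ (v :: l) := by
  refine ⟨List.nodup_cons.2 ⟨fun h => by simpa using hl.2.2 v h, hl.1⟩, ?_,
    fun _ _ => Finset.mem_univ _⟩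
  rw [List.isChain_cons]
  refine ⟨fun y hy => ?_, hl.2.1⟩
  simpa using hl.2.2 y (List.mem_of_mem_head? hy)

theorem localBeta_neighbor_lt_beta (ht : 2 ≤ t) (hT : T ∈ G.cliqueFinset t) (hv : v ∈ T) :
    localBeta G (G.neighborFinset v) (T.erase v) + 1 ≤ beta G T := by
  have h := mem_cliquesIn.1 (erase_mem_cliquesIn hT hv)
  obtain ⟨l, hl, hlen, hTl⟩ := exists_isPathList
    (listLengths_nonempty h.2.2 h.1 (by rw [← Finset.card_pos]; omega))
  have := hl.cons_neighbor.length_le_localBeta (T := T) fun x hx => by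
    by_cases hxv : x = v
    · rw [hxv]; exact List.mem_cons_self
    · exact List.mem_cons_of_mem _ (hTl x (Finset.mem_erase.2 ⟨hxv, hx⟩))
  rw [List.length_cons, hlen, ← beta_eq_localBeta] at this
  omega

/-- The `- 1` in the weight pays for the vertex `v` lost on passing to the neighbourhood. -/
theorem weight_le_through (ht : 3 ≤ t) (hT : T ∈ G.cliqueFinset t) (hv : v ∈ T) :
    weight G t T ≤
      1 / ((localBeta G (G.neighborFinset v) (T.erase v)).choose (t - 1 - 1) : ℝ) := by
  have h := choose_localBeta_pos (erase_mem_cliquesIn hT hv)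
  have h2 := localBeta_neighbor_lt_beta (by omega) hT hv
  rw [weight, weightFun, show t - 2 = t - 1 - 1 by omega]
  refine one_div_le_one_div_of_le (by exact_mod_cast h) ?_
  exact_mod_cast Nat.choose_le_choose _ (by omega)

theorem sum_weight_through_le (ht : 3 ≤ t) (v : V) :
    ∑ T ∈ (G.cliqueFinset t).filter (fun T => v ∈ T), weight G t T ≤
      localSum G (G.neighborFinset v) (t - 1) := by
  rw [localSum, ← sum_cliques_through (by omega) v
    fun S => 1 / ((localBeta G (G.neighborFinset v) S).choose (t - 1 - 1) : ℝ)]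
  refine Finset.sum_le_sum fun T hT => ?_
  rw [Finset.mem_filter] at hT
  exact weight_le_through ht hT.1 hT.2

theorem sum_degree_div (ht : 3 ≤ t) :
    ∑ v, (G.degree v : ℝ) / ((t - 1 : ℕ) : ℝ) =
      t * ((G.edgeFinset.card : ℝ) / (t.choose 2 : ℝ)) := by
  rw [← Finset.sum_div, ← Nat.cast_sum, sum_degrees_eq_twice_card_edges, Nat.cast_choose_two,
    Nat.cast_sub (by omega), Nat.cast_mul]
  have h1 : (t : ℝ) ≠ 0 := by exact_mod_cast (by omega : t ≠ 0)
  have h2 : (t : ℝ) - 1 ≠ 0 := by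
    have : (3 : ℝ) ≤ t := by exact_mod_cast ht
    linarith
  push_cast
  field_simp

theorem sum_weight_through_le_degree (ht : 3 ≤ t) (v : V) :
    ∑ T ∈ (G.cliqueFinset t).filter (fun T => v ∈ T), weight G t T ≤
      (G.degree v : ℝ) / ((t - 1 : ℕ) : ℝ) :=
  (sum_weight_through_le ht v).trans (localSum_le (by omega) _).1

theorem sum_weight_le (ht : 3 ≤ t) :
    ∑ T ∈ G.cliqueFinset t, weight G t T ≤ (G.edgeFinset.card : ℝ) / (t.choose 2 : ℝ) := by
  have ht0 : (0 : ℝ) < t := by exact_mod_cast (by omega : 0 < t)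
  refine le_of_mul_le_mul_left ?_ ht0
  rw [← sum_sum_cliques_through, ← sum_degree_div ht]
  exact Finset.sum_le_sum fun v _ => sum_weight_through_le_degree ht v

theorem sum_weight_eq_iff (ht : 3 ≤ t) :
    ∑ T ∈ G.cliqueFinset t, weight G t T = (G.edgeFinset.card : ℝ) / (t.choose 2 : ℝ) ↔
      ∀ v, ∑ T ∈ (G.cliqueFinset t).filter (fun T => v ∈ T), weight G t T =
        (G.degree v : ℝ) / ((t - 1 : ℕ) : ℝ) := by
  have ht0 : (t : ℝ) ≠ 0 := by exact_mod_cast (by omega : t ≠ 0)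
  rw [← mul_right_inj' ht0, ← sum_sum_cliques_through, ← sum_degree_div ht,
    Finset.sum_eq_sum_iff_of_le fun v _ => sum_weight_through_le_degree ht v]
  simp

/-! ### Equality in the localized bound -/

/-- Adjacency is transitive: every component of `G` is complete. -/
def IsTransitive (G : SimpleGraph V) : Prop :=
  ∀ a b c, G.Adj a b → G.Adj b c → a ≠ c → G.Adj a c

theorem isTransitive_of_sum_weight_eq (ht : 3 ≤ t)
    (h : ∑ T ∈ G.cliqueFinset t, weight G t T = (G.edgeFinset.card : ℝ) / (t.choose 2 : ℝ)) :
    IsTransitive G ∧ ∀ v, G.degree v = 0 ∨ t ≤ G.degree v + 1 := by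
  rw [sum_weight_eq_iff ht] at h
  have hloc : ∀ v, localSum G (G.neighborFinset v) (t - 1) =
      ((G.neighborFinset v).card : ℝ) / ((t - 1 : ℕ) : ℝ) := fun v =>
    le_antisymm (localSum_le (by omega) _).1 (by
      rw [card_neighborFinset_eq_degree, ← h v]
      exact sum_weight_through_le ht v)
  have hD : ∀ v, IsCliqueUnionOn G (G.neighborFinset v) (t - 1) := fun v =>
    (localSum_le (by omega) _).2 (hloc v)
  -- Equality of the sums forces equality of the terms, and the binomial coefficient is strictly
  -- monotone here.
  have hbeta : ∀ v, ∀ T ∈ G.cliqueFinset t, v ∈ T →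
      beta G T ≤ localBeta G (G.neighborFinset v) (T.erase v) + 1 := by
    intro v T hT hv
    by_contra hlt
    have hsum := h v
    rw [← card_neighborFinset_eq_degree, ← hloc v, localSum, ← sum_cliques_through (by omega) v
      fun S => 1 / ((localBeta G (G.neighborFinset v) S).choose (t - 1 - 1) : ℝ)] at hsum
    have heq := (Finset.sum_eq_sum_iff_of_le fun T hT =>
      weight_le_through ht (Finset.mem_filter.1 hT).1 (Finset.mem_filter.1 hT).2).1 hsum T
      (Finset.mem_filter.2 ⟨hT, hv⟩)
    have hc := erase_mem_cliquesIn hT hv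
    have hle := card_le_localBeta (mem_cliquesIn.1 hc).2.2 (mem_cliquesIn.1 hc).1
    rw [(mem_cliquesIn.1 hc).2.1] at hle
    rw [weight, weightFun, one_div, one_div, inv_inj, Nat.cast_inj,
      show t - 2 = t - 1 - 1 by omega] at heq
    exact (choose_lt_choose_left (by omega) (by omega)
      (show localBeta G (G.neighborFinset v) (T.erase v) < beta G T - 1 by omega)).ne' heq
  constructor
  · intro a v c hav hvc hac
    by_contra hnac
    obtain ⟨S, hSN, hS, haS⟩ := (hD v).cover a (by simpa using hav.symm)
    have hSmem : S ∈ cliquesIn G (G.neighborFinset v) (t - 1) :=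
      mem_cliquesIn.2 ⟨hSN, hS.card_eq, hS.isClique⟩
    obtain ⟨hins, hvS⟩ := insert_mem_cliqueFinset (by omega) hSmem
    obtain ⟨l, hl, hlen, hSl⟩ := exists_isPathList
      (listLengths_nonempty hS.isClique hSN ⟨a, haS⟩)
    have hcl : c ∉ l := fun hc =>
      hnac (hl.pairwise_adj (hD v).trans a (hSl a haS) c hc hac)
    -- The best path through `S` stays in the clique of `a` inside `N(v)`, hence misses `c`. Adding
    -- both `v` and `c` gains two, where `hbeta` allows one.
    have hpath : IsPathList G Finset.univ (c :: v :: l) := by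
      refine ⟨List.nodup_cons.2 ⟨?_, hl.cons_neighbor.1⟩, ?_, fun _ _ => Finset.mem_univ _⟩
      · rw [List.mem_cons]
        exact not_or.2 ⟨hvc.ne', hcl⟩
      · exact List.isChain_cons_cons.2 ⟨hvc.symm, hl.cons_neighbor.2.1⟩
    have h1 := hpath.length_le_localBeta (T := insert v S) fun x hx => by
      rcases Finset.mem_insert.1 hx with rfl | hx
      · simp
      · simp [hSl x hx]
    have h2 := hbeta v _ hins (Finset.mem_insert_self _ _)
    rw [Finset.erase_insert hvS] at h2
    rw [← beta_eq_localBeta, List.length_cons, List.length_cons, hlen] at h1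
    omega
  · intro v
    rcases Nat.eq_zero_or_pos (G.degree v) with h0 | h0
    · exact Or.inl h0
    · right
      rw [← card_neighborFinset_eq_degree] at h0
      obtain ⟨w, hw⟩ := Finset.card_pos.1 h0
      obtain ⟨S, hSN, hS, -⟩ := (hD v).cover w hw
      have := Finset.card_le_card hSN
      rw [hS.card_eq, card_neighborFinset_eq_degree] at this
      omega

/-- The closed neighbourhood of `v` is a clique that no path through `v` can leave, and any listing
of it is a path. -/
theorem beta_eq_degree (htr : IsTransitive G) (hT : T ∈ G.cliqueFinset t) (hv : v ∈ T) :
    beta G T = G.degree v := by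
  rw [mem_cliqueFinset_iff] at hT
  have hTN : T ⊆ insert v (G.neighborFinset v) := by
    intro x hx
    rw [Finset.mem_insert, mem_neighborFinset]
    by_cases hxv : x = v
    · exact Or.inl hxv
    · exact Or.inr (hT.isClique hv hx (Ne.symm hxv))
  have hcard : (insert v (G.neighborFinset v)).card = G.degree v + 1 := by
    rw [Finset.card_insert_of_notMem (by simp), card_neighborFinset_eq_degree]
  have hcl : G.IsClique (insert v (G.neighborFinset v) : Finset V) := by
    intro a ha b hb hab
    rw [Finset.mem_coe, Finset.mem_insert, mem_neighborFinset] at ha hb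
    rcases ha with rfl | ha <;> rcases hb with rfl | hb
    · exact absurd rfl hab
    · exact hb
    · exact ha.symm
    · exact htr a v b ha.symm hb hab
  rw [beta_eq_localBeta]
  apply le_antisymm
  · obtain ⟨l, hl, hlen, hTl⟩ := exists_isPathList
      (listLengths_nonempty hT.isClique (Finset.subset_univ T) ⟨v, hv⟩)
    have hadj := hl.pairwise_adj fun a _ b _ c _ => htr a b c
    have : IsPathList G (insert v (G.neighborFinset v)) l := by
      refine ⟨hl.1, hl.2.1, fun x hx => ?_⟩
      rw [Finset.mem_insert, mem_neighborFinset]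
      by_cases hxv : x = v
      · exact Or.inl hxv
      · exact Or.inr (hadj v (hTl v hv) x hx (Ne.symm hxv))
    have := this.length_le
    omega
  · have := (isPathList_toList hcl (Finset.subset_univ _)).length_le_localBeta (T := T)
      fun x hx => Finset.mem_toList.2 (hTN hx)
    rw [Finset.length_toList, hcard] at this
    omega

theorem cliquesIn_neighbor_card (htr : IsTransitive G) (v : V) :
    (cliquesIn G (G.neighborFinset v) (t - 1)).card = (G.degree v).choose (t - 1) := by
  rw [← card_neighborFinset_eq_degree, ← Finset.card_powersetCard, cliquesIn,
    Finset.filter_true_of_mem]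
  intro S hS a ha b hb hab
  have hS := (Finset.mem_powersetCard.1 hS).1
  have h1 := hS ha
  have h2 := hS hb
  rw [mem_neighborFinset] at h1 h2
  exact htr a v b h1.symm h2 hab

/-- With `d = deg(v)`, the `binom(d, t - 1)` cliques through `v` all weigh `1 / binom(d - 1, t -
2)`; absorption gives `d / (t - 1)`. -/
theorem sum_weight_eq_of_isTransitive (ht : 3 ≤ t) (htr : IsTransitive G)
    (hdeg : ∀ v, G.degree v = 0 ∨ t ≤ G.degree v + 1) :
    ∑ T ∈ G.cliqueFinset t, weight G t T = (G.edgeFinset.card : ℝ) / (t.choose 2 : ℝ) := by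
  rw [sum_weight_eq_iff ht]
  intro v
  have h1 := sum_cliques_through (G := G) (t := t) (by omega) v
    fun _ => weightFun t (G.degree v)
  rw [Finset.sum_congr rfl fun T hT => show weight G t T = weightFun t (G.degree v) by
    rw [weight, beta_eq_degree htr (Finset.mem_filter.1 hT).1 (Finset.mem_filter.1 hT).2], h1,
    Finset.sum_const, nsmul_eq_mul, cliquesIn_neighbor_card htr, weightFun, mul_one_div]
  rcases hdeg v with h0 | h0
  · rw [h0, Nat.choose_eq_zero_of_lt (by omega)]
    simp
  · have hid := Nat.add_one_mul_choose_eq (G.degree v - 1) (t - 2)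
    rw [Nat.sub_add_cancel (by omega), show t - 2 + 1 = t - 1 by omega] at hid
    rw [div_eq_div_iff]
    · exact_mod_cast hid.symm
    · exact_mod_cast (Nat.choose_pos (by omega)).ne'
    · exact_mod_cast (by omega : t - 1 ≠ 0)

end

/-! ### Complete components and the Chakraborti–Chen bound -/

section

variable [Fintype V] [DecidableEq V] {G : SimpleGraph V} [DecidableRel G.Adj]
  {t m r : ℕ} {T : Finset V} {v : V}

theorem IsTransitive.mem_supp_iff (htr : IsTransitive G) {v w : V} :
    w ∈ (G.connectedComponentMk v).supp ↔ w ∈ insert v (G.neighborFinset v) := by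
  rw [ConnectedComponent.mem_supp_iff, ConnectedComponent.eq, Finset.mem_insert,
    mem_neighborFinset]
  constructor
  · intro h
    replace h := (reachable_iff_reflTransGen v w).1 h.symm
    induction h with
    | refl => exact Or.inl rfl
    | @tail b c _ hbc ih =>
      by_cases hcv : c = v
      · exact Or.inl hcv
      rcases ih with rfl | ih
      · exact Or.inr hbc
      · exact Or.inr (htr v b c ih hbc (Ne.symm hcv))
  · rintro (rfl | h)
    · exact Reachable.refl _
    · exact h.symm.reachable

theorem card_insert_neighborFinset (v : V) :
    (insert v (G.neighborFinset v)).card = G.degree v + 1 := by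
  rw [Finset.card_insert_of_notMem (by simp), card_neighborFinset_eq_degree]

theorem IsTransitive.card_component (htr : IsTransitive G) (v : V) :
    Nat.card (G.connectedComponentMk v) = G.degree v + 1 := by
  rw [← card_insert_neighborFinset]
  exact Nat.subtype_card _ fun x => htr.mem_supp_iff.symm

/-- Under transitivity the component of `v` is its closed neighbourhood, so component orders can be
read off degrees. -/
theorem isDisjointUnion_iff (N : Set ℕ) :
    IsDisjointUnionOfCompleteGraphs G N ↔ IsTransitive G ∧ ∀ v, G.degree v + 1 ∈ N := by
  constructor
  · intro h
    have htr : IsTransitive G := by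
      intro a b c hab hbc hac
      obtain ⟨k, -, ⟨e⟩⟩ := h (G.connectedComponentMk a)
      have hc : c ∈ G.connectedComponentMk a :=
        ConnectedComponent.eq.2 (hab.reachable.trans hbc.reachable).symm
      have ha : a ∈ G.connectedComponentMk a := rfl
      rw [← ConnectedComponent.toSimpleGraph_adj _ ha hc, ← e.map_adj_iff]
      exact fun heq => hac (congrArg Subtype.val (e.injective heq))
    refine ⟨htr, fun v => ?_⟩
    obtain ⟨k, hk, ⟨e⟩⟩ := h (G.connectedComponentMk v)
    have := Nat.card_congr e.toEquiv
    rw [htr.card_component, Nat.card_fin] at this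
    rwa [this]
  · rintro ⟨htr, hN⟩ c
    induction c using ConnectedComponent.ind with
    | h v =>
      refine ⟨_, hN v, ⟨?_⟩⟩
      have e := Finite.equivFinOfCardEq (htr.card_component v)
      refine ⟨e, ?_⟩
      rintro ⟨a, ha⟩ ⟨b, hb⟩
      rw [completeGraph_eq_top, top_adj, ConnectedComponent.toSimpleGraph_adj, e.injective.ne_iff,
        Ne, Subtype.mk.injEq]
      refine ⟨fun hab => ?_, fun h => h.ne⟩
      have ha := htr.mem_supp_iff.1 ha
      have hb := htr.mem_supp_iff.1 hb
      rw [Finset.mem_insert, mem_neighborFinset] at ha hb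
      rcases ha with rfl | ha <;> rcases hb with rfl | hb
      · exact absurd rfl hab
      · exact hb
      · exact ha.symm
      · exact htr a v b ha.symm hb hab

theorem sum_weight_eq_iff_isDisjointUnion (ht : 3 ≤ t) :
    ∑ T ∈ G.cliqueFinset t, weight G t T = (G.edgeFinset.card : ℝ) / (t.choose 2 : ℝ) ↔
      IsDisjointUnionOfCompleteGraphs G {k | k = 1 ∨ t ≤ k} := by
  have hiff : IsDisjointUnionOfCompleteGraphs G {k | k = 1 ∨ t ≤ k} ↔
      IsTransitive G ∧ ∀ v, G.degree v = 0 ∨ t ≤ G.degree v + 1 := by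
    rw [isDisjointUnion_iff]
    simp
  rw [hiff]
  exact ⟨isTransitive_of_sum_weight_eq ht, fun h => sum_weight_eq_of_isTransitive ht h.1 h.2⟩

theorem beta_lt_of_free (hr : (pathGraph (r + 1)).Free G) (ht : 1 ≤ t)
    (hT : T ∈ G.cliqueFinset t) : beta G T < r := by
  by_contra hlt
  rw [not_lt] at hlt
  rw [mem_cliqueFinset_iff] at hT
  obtain ⟨l, hl, hlen, -⟩ := exists_isPathList (listLengths_nonempty hT.isClique
    (Finset.subset_univ T) (by rw [← Finset.card_pos, hT.card_eq]; omega))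
  rw [← beta_eq_localBeta] at hlen
  -- An initial segment of the long path may miss `T`, hence the `∅`.
  have hmem : r ∈ pathLengths G ∅ := by
    rw [pathLengths_eq]
    exact ⟨l.take (r + 1), ⟨hl.1.sublist (List.take_sublist _ _), hl.2.1.take _,
      fun _ _ => Finset.mem_univ _⟩, by rw [List.length_take]; omega, by simp⟩
  obtain ⟨S, -, ⟨e⟩⟩ := hmem
  exact hr ⟨S.coeCopy.comp e.symm.toCopy⟩

theorem div_mul_choose (ht : 3 ≤ t) (htr : t ≤ r) (x : ℝ) :
    x / (r.choose 2 : ℝ) * (r.choose t : ℝ) =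
      x / (t.choose 2 : ℝ) * ((r - 2).choose (t - 2) : ℝ) := by
  have h : (r.choose t : ℝ) * (t.choose 2 : ℝ) = (r.choose 2 : ℝ) * ((r - 2).choose (t - 2) : ℝ) := by
    exact_mod_cast Nat.choose_mul (n := r) (by omega : 2 ≤ t)
  have h1 : (r.choose 2 : ℝ) ≠ 0 := by exact_mod_cast (Nat.choose_pos (by omega)).ne'
  have h2 : (t.choose 2 : ℝ) ≠ 0 := by exact_mod_cast (Nat.choose_pos (by omega)).ne'
  rw [div_mul_eq_mul_div, div_mul_eq_mul_div, div_eq_div_iff h1 h2, mul_assoc, h]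
  ring

/-- The non-isolated vertices split into components of order `r`, so there are `r * q` of them, and
the degree sum is `r * q * (r - 1)`. -/
theorem choose_two_dvd_card_edgeFinset (hr : 2 ≤ r) (htr : IsTransitive G)
    (hdeg : ∀ v, G.degree v = 0 ∨ G.degree v + 1 = r) : r.choose 2 ∣ G.edgeFinset.card := by
  let s : Finset V := Finset.univ.filter fun v => G.degree v ≠ 0
  have hdvd : r ∣ s.card := by
    classical
    rw [Finset.card_eq_sum_card_image G.connectedComponentMk s]
    refine Finset.dvd_sum fun c hc => ?_
    obtain ⟨v, hv, rfl⟩ := Finset.mem_image.1 hc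
    have hv0 : G.degree v ≠ 0 := (Finset.mem_filter.1 hv).2
    have : (s.filter fun w => G.connectedComponentMk w = G.connectedComponentMk v) =
        insert v (G.neighborFinset v) := by
      ext w
      rw [Finset.mem_filter, ← htr.mem_supp_iff, ConnectedComponent.mem_supp_iff]
      refine ⟨fun h => h.2, fun h => ⟨?_, h⟩⟩
      simp only [s, Finset.mem_filter, Finset.mem_univ, true_and]
      have h1 := htr.card_component w
      rw [h, htr.card_component v] at h1
      omega
    rw [this, card_insert_neighborFinset, (hdeg v).resolve_left hv0]
  obtain ⟨q, hq⟩ := hdvd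
  refine ⟨q, ?_⟩
  have hsum : ∑ v, G.degree v = s.card * (r - 1) := by
    rw [← smul_eq_mul, ← Finset.sum_const, ← Finset.sum_filter_ne_zero]
    refine Finset.sum_congr rfl fun v hv => ?_
    have := (hdeg v).resolve_left (Finset.mem_filter.1 hv).2
    omega
  rw [sum_degrees_eq_twice_card_edges, hq] at hsum
  have h2 : r.choose 2 * 2 = r * (r - 1) := by
    rw [Nat.choose_two_right, Nat.div_mul_cancel (Nat.even_mul_pred_self r).two_dvd]
  have : 2 * G.edgeFinset.card = 2 * (r.choose 2 * q) := by
    rw [hsum, ← mul_assoc, mul_comm 2, h2]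
    ring
  omega

theorem weightFun_le_weight (ht : 3 ≤ t) (hr : (pathGraph (r + 1)).Free G)
    (hT : T ∈ G.cliqueFinset t) : weightFun t (r - 1) ≤ weight G t T := by
  have h1 := beta_lt_of_free hr (by omega) hT
  have h2 := le_beta hT
  exact (weightFun_strictAntiOn ht).antitoneOn (Set.mem_Ici.2 h2) (Set.mem_Ici.2 (by omega))
    (by omega)

theorem card_cliqueFinset_le (ht : 3 ≤ t) (htr : t ≤ r) (hr : (pathGraph (r + 1)).Free G) :
    ((G.cliqueFinset t).card : ℝ) ≤
      (G.edgeFinset.card : ℝ) / (r.choose 2 : ℝ) * (r.choose t : ℝ) := by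
  have h := (Finset.sum_le_sum fun T hT => weightFun_le_weight ht hr hT).trans
    (sum_weight_le (G := G) ht)
  have hpos : (0 : ℝ) < ((r - 2).choose (t - 2) : ℝ) := by
    exact_mod_cast Nat.choose_pos (by omega)
  rw [Finset.sum_const, nsmul_eq_mul, weightFun, mul_one_div, Nat.sub_sub, div_le_iff₀ hpos] at h
  rwa [div_mul_choose ht htr]

/-- Equality forces equality in the localized bound and `β = r - 1` on every `t`-clique. Each
non-isolated vertex then lies in such a clique, where `β` is its degree. -/
theorem card_cliqueFinset_eq_iff (ht : 3 ≤ t) (htr : t ≤ r) (hr : (pathGraph (r + 1)).Free G) :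
    ((G.cliqueFinset t).card : ℝ) =
        (G.edgeFinset.card : ℝ) / (r.choose 2 : ℝ) * (r.choose t : ℝ) ↔
      r.choose 2 ∣ G.edgeFinset.card ∧
        IsDisjointUnionOfCompleteGraphs G {k | k = 1 ∨ k = r} := by
  have hpos : (0 : ℝ) < ((r - 2).choose (t - 2) : ℝ) := by
    exact_mod_cast Nat.choose_pos (by omega)
  have hconst : ∑ _T ∈ G.cliqueFinset t, weightFun t (r - 1) =
      ((G.cliqueFinset t).card : ℝ) / ((r - 2).choose (t - 2) : ℝ) := by
    rw [Finset.sum_const, nsmul_eq_mul, weightFun, mul_one_div, Nat.sub_sub]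
  have hiff : IsDisjointUnionOfCompleteGraphs G {k | k = 1 ∨ k = r} ↔
      IsTransitive G ∧ ∀ v, G.degree v = 0 ∨ G.degree v + 1 = r := by
    rw [isDisjointUnion_iff]
    simp
  have hle : ∀ T ∈ G.cliqueFinset t, weightFun t (r - 1) ≤ weight G t T := fun T hT =>
    weightFun_le_weight ht hr hT
  rw [div_mul_choose ht htr, ← div_eq_iff hpos.ne', ← hconst, hiff]
  constructor
  · intro h
    have h1 := Finset.sum_le_sum hle
    have h2 := sum_weight_le (G := G) ht
    obtain ⟨htrans, hdeg⟩ := isTransitive_of_sum_weight_eq (G := G) ht (by linarith)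
    have heq := (Finset.sum_eq_sum_iff_of_le hle).1 (by linarith)
    have hdeg' : ∀ v, G.degree v = 0 ∨ G.degree v + 1 = r := by
      intro v
      refine (hdeg v).imp_right fun hv => ?_
      have hcard := cliquesIn_neighbor_card (t := t) htrans v
      have : 0 < (cliquesIn G (G.neighborFinset v) (t - 1)).card := by
        rw [hcard]; exact Nat.choose_pos (by omega)
      obtain ⟨S, hS⟩ := Finset.card_pos.1 this
      have hT := (insert_mem_cliqueFinset (by omega) hS).1
      have hb := beta_eq_degree htrans hT (Finset.mem_insert_self v S)
      have hw := (weightFun_strictAntiOn ht).injOn (Set.mem_Ici.2 (by omega))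
        (Set.mem_Ici.2 (le_beta hT)) (heq _ hT)
      omega
    exact ⟨choose_two_dvd_card_edgeFinset (by omega) htrans hdeg', htrans, hdeg'⟩
  · rintro ⟨-, htrans, hdeg⟩
    rw [← sum_weight_eq_of_isTransitive ht htrans fun v => (hdeg v).imp_right fun h => by omega]
    refine Finset.sum_congr rfl fun T hT => ?_
    obtain ⟨v, hv⟩ : T.Nonempty := by
      rw [← Finset.card_pos, (mem_cliqueFinset_iff.1 hT).card_eq]; omega
    have h1 := le_beta hT
    rw [beta_eq_degree htrans hT hv] at h1
    rw [weight, beta_eq_degree htrans hT hv]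
    congr 1
    rcases hdeg v with h | h <;> omega

end

end LocalPath

theorem mainTheorem5 {V : Type*} [Fintype V] [DecidableEq V]
    (G : SimpleGraph V) [DecidableRel G.Adj] (t m : ℕ) (ht : 3 ≤ t)
    (hm : G.edgeFinset.card = m) :
    -- the weight is well-defined: the maximum exists and the binomial coefficient is positive
    (∀ T ∈ G.cliqueFinset t,
      IsGreatest (LocalPath.pathLengths G T) (LocalPath.beta G T) ∧
      t - 1 ≤ LocalPath.beta G T ∧
      0 < (LocalPath.beta G T - 1).choose (t - 2)) ∧
    -- the weight is decreasing in the size function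
    StrictAntiOn (LocalPath.weightFun t) (Set.Ici (t - 1)) ∧
    -- the localized bound
    ∑ T ∈ G.cliqueFinset t, LocalPath.weight G t T ≤ (m : ℝ) / (t.choose 2 : ℝ) ∧
    -- the case of equality
    (∑ T ∈ G.cliqueFinset t, LocalPath.weight G t T = (m : ℝ) / (t.choose 2 : ℝ) ↔
      LocalPath.IsDisjointUnionOfCompleteGraphs G {k | k = 1 ∨ t ≤ k}) ∧
    -- the bound for graphs without a path on `r + 1` vertices, and its case of equality
    (∀ r : ℕ, t ≤ r → (SimpleGraph.pathGraph (r + 1)).Free G →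
      ((G.cliqueFinset t).card : ℝ) ≤ (m : ℝ) / (r.choose 2 : ℝ) * (r.choose t : ℝ) ∧
      (((G.cliqueFinset t).card : ℝ) = (m : ℝ) / (r.choose 2 : ℝ) * (r.choose t : ℝ) ↔
        r.choose 2 ∣ m ∧
        LocalPath.IsDisjointUnionOfCompleteGraphs G {k | k = 1 ∨ k = r})) := by
  subst hm
  refine ⟨fun T hT => ?_, LocalPath.weightFun_strictAntiOn ht, LocalPath.sum_weight_le ht,
    LocalPath.sum_weight_eq_iff_isDisjointUnion ht, fun r htr hr =>
      ⟨LocalPath.card_cliqueFinset_le ht htr hr, LocalPath.card_cliqueFinset_eq_iff ht htr hr⟩⟩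
  have h := LocalPath.le_beta hT
  exact ⟨LocalPath.isGreatest_beta (by omega) hT, h, Nat.choose_pos (by omega)⟩
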